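/- **Theorem.** Write $V(H^k)=\{0,1\}^k$ with Hamming distance $d$ and addition mod 2, and let $\bar 1$ be the all-one word. A distance-3 code is a set of words whose distinct members are at pairwise distance at least 3. A set $C\subseteq V(H^k)$ is a 1-perfect code if every $\bar x\in V(H^k)$ is at distance 0 or 1 from exactly one word of $C$; a multiset $B$ over $V(H^k)$ is a twofold 1-perfect code if every $\bar x\in V(H^k)$ is at distance 0 or 1 from exactly two words of $B$, counted with multiplicity. A multiset (in particular, a set) is splittable if it is the multiset union (multiplicities added) of two distance-3 codes. Let $m\ge 3$, $n=2^m-3$, and let $C_1\subset V(H^n)$ be a distance-3 code of cardinality $2^{2^m-m-3}$. Put $$C_2=C_1+\bar 1,\qquad C_3=\{\bar x\mid d(\bar x,C_1)=1\}\setminus C_2,\qquad C_4=V(H^n)\setminus(C_1\cup C_2\cup C_3),$$ and $C_100=\{\bar x00\mid \bar x\in C_1\}\subset V(H^{n+2})$. Then: - there is a unique twofold 1-perfect code $B$ over $V(H^{n+2})$ such that $C_100\subset B$, every word of $C_100$ has multiplicity 2 in $B$, and $\bar w+0\ldots011\in B$ for every $\bar w\in B$ whose last two symbols are $01$ or $10$;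 - there is a unique twofold 1-perfect code $D$ over $V(H^{n+2})$ such that $C_100\subset D$ and $\bar w+0\ldots011\in D$ for every $\bar w\in D$; and for these $B$ and $D$ the following four statements are equivalent: (a) $C_100$ is a subset of some 1-perfect code $C\subset V(H^{n+2})$; (b) $C_4$ is splittable; (c) $B$ is splittable; (d) $D$ is splittable. -/

import Mathlib

/-- Binary words of length `n`, the vertices of the `n`-cube; addition is coordinatewise mod 2,
and `1` is the all-one word. -/
abbrev BinWord (n : ℕ) : Type := Fin n → ZMod 2

/-- The concatenation `x a b` of a word `x` with two further symbols. -/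
def appendTwo {n : ℕ} (x : BinWord n) (a b : ZMod 2) : BinWord (n + 2) :=
  Fin.append x ![a, b]

/-- Any two different words of `C` are at Hamming distance at least 3. -/
def IsDistThreeCode {n : ℕ} (C : Finset (BinWord n)) : Prop :=
  ∀ x ∈ C, ∀ y ∈ C, x ≠ y → 3 ≤ hammingDist x y

/-- Every word is at distance 0 or 1 from exactly one codeword. -/
def IsOnePerfect {n : ℕ} (C : Finset (BinWord n)) : Prop :=
  ∀ x : BinWord n, ∃! y, y ∈ C ∧ hammingDist x y ≤ 1

/-- Every word is at distance 0 or 1 from exactly two codewords of the multiset `B`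
(counted with multiplicity). -/
def IsTwofoldOnePerfect {n : ℕ} (B : Multiset (BinWord n)) : Prop :=
  ∀ x : BinWord n, B.countP (fun y => hammingDist x y ≤ 1) = 2

/-- The multiset `B` is the multiset union (multiplicities are added) of two distance-3 codes. -/
def IsSplittable {n : ℕ} (B : Multiset (BinWord n)) : Prop :=
  ∃ C' C'' : Finset (BinWord n), IsDistThreeCode C' ∧ IsDistThreeCode C'' ∧ B = C'.val + C''.val

/-- `C₂ = C₁ + 1…1`. -/
def partTwo {n : ℕ} (C₁ : Finset (BinWord n)) : Finset (BinWord n) :=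
  Finset.univ.filter fun x => x + 1 ∈ C₁

/-- `C₃ = {x | d(x, C₁) = 1} \ C₂`; the distance from `x` to `C₁` is 1 when `x` is not in `C₁`
but some word of `C₁` is at distance 1 from `x`. -/
def partThree {n : ℕ} (C₁ : Finset (BinWord n)) : Finset (BinWord n) :=
  (Finset.univ.filter fun x => x ∉ C₁ ∧ ∃ y ∈ C₁, hammingDist x y = 1) \ partTwo C₁

/-- `C₄` is the complement of `C₁ ∪ C₂ ∪ C₃`. -/
def partFour {n : ℕ} (C₁ : Finset (BinWord n)) : Finset (BinWord n) :=
  Finset.univ \ (C₁ ∪ partTwo C₁ ∪ partThree C₁)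

/-- `B` is a twofold 1-perfect code that includes `C₁00`, in which every word of `C₁00` has
multiplicity 2, and such that `w + 0…011` is a codeword for every codeword `w` whose last two
symbols are `01` or `10`. -/
def IsDoubledTwofoldExtension {n : ℕ} (C₁ : Finset (BinWord n))
    (B : Multiset (BinWord (n + 2))) : Prop :=
  IsTwofoldOnePerfect B ∧
  (∀ x ∈ C₁, appendTwo x 0 0 ∈ B) ∧
  (∀ x ∈ C₁, B.count (appendTwo x 0 0) = 2) ∧
  (∀ x : BinWord n, appendTwo x 0 1 ∈ B → appendTwo x 0 1 + appendTwo 0 1 1 ∈ B) ∧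
  (∀ x : BinWord n, appendTwo x 1 0 ∈ B → appendTwo x 1 0 + appendTwo 0 1 1 ∈ B)

/-- `D` is a twofold 1-perfect code that includes `C₁00` and such that `w + 0…011` is a codeword
for every codeword `w`. -/
def IsInvariantTwofoldExtension {n : ℕ} (C₁ : Finset (BinWord n))
    (D : Multiset (BinWord (n + 2))) : Prop :=
  IsTwofoldOnePerfect D ∧
  (∀ x ∈ C₁, appendTwo x 0 0 ∈ D) ∧
  (∀ w ∈ D, w + appendTwo 0 1 1 ∈ D)

open Finset

/-! A code is studied through its indicator `f` and the operator `ballSum`, whose eigenvectors are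
the characters of the cube: distance 3 means ball sums at most 1, 1-perfect means ball sums 1,
twofold means 2.

The cardinality of `C₁` is extremal. By Parseval, summing `(λ² - 2 - 2χ(1))·|f̂|²` over all
characters gives at most the contribution of the trivial one. As n ≡ 1 (mod 4), no term is negative,
so all nontrivial terms vanish (`cubeFourier_codeInd_vanish`). Hence the indicators `f, f', h` of
`C₁, C₂, C₄` satisfy `ballSum f = ballSum f' = 1 - h` and `ballSum h = 2 - 2(f + f')`.

Cut a multiset over the longer words into four slices by the last two symbols 00, 01, 10, 11. The
ball sums above and `rigidity` force the slices `2f, h, h, 2f'` for `B` and `f + f', h, h, f + f'`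
for `D`, which gives existence and uniqueness.

If a 1-perfect `C` contains `C₁00`, then `C` plus its image under the swap of the last two symbols
must be `B`, and `C` plus its translate by 0…011 must be `D`. A splitting of `B` or `D` restricts to
one of the slice `C₄`. Conversely, if `C₄` splits into `K'` and `K''`, the slices `C₁, K', K'', C₂`
form a 1-perfect code. -/

/-! ### Ball sums and indicators of codes -/

/-- The sum of `F` over the ball of radius 1 centered at `x`. -/
def ballSum {n : ℕ} (F : BinWord n → ℤ) (x : BinWord n) : ℤ :=
  ∑ y with hammingDist x y ≤ 1, F y

/-- The integer-valued indicator function of a code. -/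
def codeInd {n : ℕ} (C : Finset (BinWord n)) (x : BinWord n) : ℤ := if x ∈ C then 1 else 0

theorem ZMod.ne_iff_eq_add_one_of_two (a b : ZMod 2) : a ≠ b ↔ b = a + 1 := by
  revert a b; decide

theorem ZMod.eq_zero_or_eq_one_of_two (a : ZMod 2) : a = 0 ∨ a = 1 := by
  revert a; decide

theorem hammingDist_le_one_iff {n : ℕ} (x y : BinWord n) :
    hammingDist x y ≤ 1 ↔ y = x ∨ ∃ i, x + Pi.single i 1 = y := by
  constructor
  · intro h
    by_cases hxy : y = x
    · exact Or.inl hxy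
    · right
      obtain ⟨i, hi⟩ := Function.ne_iff.mp hxy
      refine ⟨i, funext fun j => ?_⟩
      rcases eq_or_ne j i with rfl | hj
      · simpa using ((ZMod.ne_iff_eq_add_one_of_two _ _).mp hi.symm).symm
      · simp only [Pi.add_apply, Pi.single_eq_of_ne hj, add_zero]
        by_contra hne
        exact hj (Finset.card_le_one.mp h j (by simpa using hne) i (by simpa using hi.symm))
  · rintro (rfl | ⟨i, rfl⟩)
    · simp
    · refine (card_le_card (t := {i}) fun j hj => ?_).trans (card_singleton i).le
      simp only [mem_filter, mem_univ, true_and, Pi.add_apply] at hj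
      by_contra hne
      rw [mem_singleton] at hne
      simp [Pi.single_eq_of_ne hne] at hj

theorem ballSum_eq {n : ℕ} (F : BinWord n → ℤ) (x : BinWord n) :
    ballSum F x = F x + ∑ i, F (x + Pi.single i 1) := by
  have hset : (univ.filter fun y : BinWord n => hammingDist x y ≤ 1) =
      insert x (univ.image fun i => x + Pi.single i 1) := by
    ext y
    simp [hammingDist_le_one_iff]
  rw [ballSum, hset, sum_insert, sum_image]
  · intro i _ j _ hij
    by_contra hne
    have := congrFun (add_left_cancel hij) i
    simp [Pi.single_eq_of_ne hne] at this
  · simp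

theorem ballSum_add {n : ℕ} (F G : BinWord n → ℤ) (x : BinWord n) :
    ballSum (fun y => F y + G y) x = ballSum F x + ballSum G x := sum_add_distrib

theorem ballSum_sub {n : ℕ} (F G : BinWord n → ℤ) (x : BinWord n) :
    ballSum (fun y => F y - G y) x = ballSum F x - ballSum G x := sum_sub_distrib _ _

theorem ballSum_const_mul {n : ℕ} (c : ℤ) (F : BinWord n → ℤ) (x : BinWord n) :
    ballSum (fun y => c * F y) x = c * ballSum F x := (mul_sum _ _ _).symm

theorem ballSum_mono {n : ℕ} {F G : BinWord n → ℤ} (h : ∀ y, F y ≤ G y) (x : BinWord n) :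
    ballSum F x ≤ ballSum G x := sum_le_sum fun y _ => h y

theorem ballSum_nonneg {n : ℕ} {F : BinWord n → ℤ} (h : ∀ y, 0 ≤ F y) (x : BinWord n) :
    0 ≤ ballSum F x := sum_nonneg fun y _ => h y

theorem le_ballSum {n : ℕ} {F : BinWord n → ℤ} (h : ∀ y, 0 ≤ F y) (x : BinWord n) :
    F x ≤ ballSum F x :=
  single_le_sum (f := F) (fun y _ => h y) (by simp)

theorem ballSum_one {n : ℕ} (x : BinWord n) : ballSum (fun _ => 1) x = n + 1 := by
  simp [ballSum_eq, add_comm]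

theorem ballSum_add_right {n : ℕ} (F : BinWord n → ℤ) (z x : BinWord n) :
    ballSum (fun y => F (y + z)) x = ballSum F (x + z) := by
  simp only [ballSum_eq, add_right_comm]

theorem codeInd_nonneg {n : ℕ} (C : Finset (BinWord n)) (x : BinWord n) : 0 ≤ codeInd C x := by
  unfold codeInd; split_ifs <;> norm_num

theorem codeInd_mul_self {n : ℕ} (C : Finset (BinWord n)) (x : BinWord n) :
    codeInd C x * codeInd C x = codeInd C x := by
  unfold codeInd; split_ifs <;> norm_num

theorem codeInd_eq_zero_or_one {n : ℕ} (C : Finset (BinWord n)) (x : BinWord n) :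
    codeInd C x = 0 ∨ codeInd C x = 1 := by
  unfold codeInd; split_ifs <;> simp

theorem sum_codeInd {n : ℕ} (C : Finset (BinWord n)) : ∑ x, codeInd C x = C.card := by
  simp [codeInd]

theorem ballSum_codeInd {n : ℕ} (C : Finset (BinWord n)) (x : BinWord n) :
    ballSum (codeInd C) x = ((C.filter fun y => hammingDist x y ≤ 1).card : ℤ) := by
  simp only [ballSum, codeInd, sum_ite_mem, sum_const, nsmul_eq_mul, mul_one]
  congr 2
  ext y
  simp [and_comm]

theorem isDistThreeCode_iff {n : ℕ} (C : Finset (BinWord n)) :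
    IsDistThreeCode C ↔ ∀ x, ballSum (codeInd C) x ≤ 1 := by
  constructor
  · intro h x
    rw [ballSum_codeInd]
    norm_cast
    refine card_le_one.mpr fun y hy z hz => ?_
    simp only [mem_filter] at hy hz
    by_contra hne
    have h1 := h y hy.1 z hz.1 hne
    have h2 := hammingDist_triangle y x z
    rw [hammingDist_comm y x] at h2
    omega
  · intro h x hx y hy hne
    by_contra hlt
    obtain ⟨i, hi⟩ := Function.ne_iff.mp hne
    -- Correcting one coordinate of `x` towards `y` gives a word within distance 1 of both, since
    -- they are at distance at most 2.
    have hz1 : hammingDist (Function.update x i (y i)) x ≤ 1 := by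
      refine (card_le_card (t := {i}) fun j hj => ?_).trans (card_singleton i).le
      by_contra hji
      rw [mem_singleton] at hji
      simp [Function.update_of_ne hji] at hj
    have hz2 : hammingDist (Function.update x i (y i)) y ≤ 1 := by
      have hsub : (univ.filter fun j => Function.update x i (y i) j ≠ y j) ⊂
          univ.filter fun j => x j ≠ y j := by
        refine (ssubset_iff_of_subset fun j hj => ?_).mpr ⟨i, by simpa using hi, by simp⟩
        rcases eq_or_ne j i with rfl | hji
        · simp at hj
        · simpa [Function.update_of_ne hji] using hj
      have := card_lt_card hsub
      simp only [hammingDist] at hlt ⊢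
      omega
    have h1 := h (Function.update x i (y i))
    rw [ballSum_codeInd] at h1
    norm_cast at h1
    exact hne (card_le_one.mp h1 x (by simp [hx, hz1]) y (by simp [hy, hz2]))

theorem isOnePerfect_iff {n : ℕ} (C : Finset (BinWord n)) :
    IsOnePerfect C ↔ ∀ x, ballSum (codeInd C) x = 1 := by
  refine forall_congr' fun x => ?_
  rw [ballSum_codeInd]
  norm_cast
  rw [card_eq_one]
  simp only [ExistsUnique, eq_singleton_iff_unique_mem, mem_filter]

theorem IsOnePerfect.isDistThreeCode {n : ℕ} {C : Finset (BinWord n)} (h : IsOnePerfect C) :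
    IsDistThreeCode C :=
  (isDistThreeCode_iff C).mpr fun x => ((isOnePerfect_iff C).mp h x).le

theorem isTwofoldOnePerfect_iff {n : ℕ} (B : Multiset (BinWord n)) :
    IsTwofoldOnePerfect B ↔ ∀ x, ballSum (fun y => (B.count y : ℤ)) x = 2 := by
  refine forall_congr' fun x => ?_
  have : (B.countP (fun y => hammingDist x y ≤ 1) : ℤ) = ballSum (fun y => (B.count y : ℤ)) x := by
    rw [Multiset.countP_eq_card_filter, ← Multiset.sum_count_eq_card (s := univ) (by simp), ballSum,
      sum_filter]
    push_cast
    refine sum_congr rfl fun y _ => ?_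
    rw [Multiset.count_filter]
    split_ifs <;> simp
  rw [← this]
  norm_cast

theorem count_val_eq_codeInd {n : ℕ} (C : Finset (BinWord n)) (x : BinWord n) :
    (C.val.count x : ℤ) = codeInd C x := by
  rw [Multiset.count_eq_of_nodup C.nodup]
  simp [codeInd]

/-! ### Fourier analysis on the cube -/

/-- The character `x ↦ (-1) ^ ⟨u, x⟩`. -/
def cubeChar {n : ℕ} (u x : BinWord n) : ℤ := ∏ i, if u i = 1 ∧ x i = 1 then -1 else 1

theorem cubeChar_add {n : ℕ} (u x y : BinWord n) :
    cubeChar u (x + y) = cubeChar u x * cubeChar u y := by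
  rw [cubeChar, cubeChar, cubeChar, ← prod_mul_distrib]
  have h : ∀ a b c : ZMod 2, (if a = 1 ∧ b + c = 1 then (-1 : ℤ) else 1) =
      (if a = 1 ∧ b = 1 then -1 else 1) * if a = 1 ∧ c = 1 then -1 else 1 := by decide
  exact prod_congr rfl fun i _ => h (u i) (x i) (y i)

theorem cubeChar_comm {n : ℕ} (u x : BinWord n) : cubeChar u x = cubeChar x u := by
  simp only [cubeChar, and_comm]

theorem cubeChar_zero_left {n : ℕ} (x : BinWord n) : cubeChar 0 x = 1 := by
  simp [cubeChar]

theorem add_self_binWord {n : ℕ} (x : BinWord n) : x + x = 0 :=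
  funext fun i => CharTwo.add_self_eq_zero (x i)

theorem add_cancel_binWord {n : ℕ} (x y : BinWord n) : x + y + y = x := by
  rw [add_assoc, add_self_binWord, add_zero]

theorem sum_cubeChar {n : ℕ} (z : BinWord n) :
    ∑ u, cubeChar u z = if z = 0 then (2 : ℤ) ^ n else 0 := by
  have h : ∑ u, cubeChar u z =
      ∏ i, ∑ a : ZMod 2, (if a = 1 ∧ z i = 1 then (-1 : ℤ) else 1) := by
    rw [prod_univ_sum, Fintype.piFinset_univ]
    rfl
  have h2 : ∀ b : ZMod 2, ∑ a : ZMod 2, (if a = 1 ∧ b = 1 then (-1 : ℤ) else 1) =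
      if b = 0 then 2 else 0 := by decide
  simp only [h, h2]
  split_ifs with hz
  · simp [hz]
  · obtain ⟨i, hi⟩ := Function.ne_iff.mp hz
    exact prod_eq_zero (mem_univ i) (if_neg hi)

/-- The Fourier transform on the `n`-cube. -/
def cubeFourier {n : ℕ} (F : BinWord n → ℤ) (u : BinWord n) : ℤ := ∑ x, F x * cubeChar u x

theorem sum_cubeFourier_mul {n : ℕ} (F G : BinWord n → ℤ) :
    ∑ u, cubeFourier F u * cubeFourier G u = 2 ^ n * ∑ x, F x * G x := by
  simp only [cubeFourier, sum_mul_sum]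
  rw [sum_comm, mul_sum]
  refine sum_congr rfl fun x _ => ?_
  rw [sum_comm]
  have : ∀ y, ∑ u, F x * cubeChar u x * (G y * cubeChar u y) =
      F x * G y * if y = x then 2 ^ n else 0 := by
    intro y
    have hxy : (y = x) ↔ x + y = 0 := by
      refine ⟨fun h => h ▸ add_self_binWord y, fun h => ?_⟩
      rw [← add_cancel_binWord x y, h, zero_add]
    simp only [hxy]
    rw [← sum_cubeChar, mul_sum]
    refine sum_congr rfl fun u _ => ?_
    rw [cubeChar_add]; ring
  simp only [this, mul_ite, mul_zero, sum_ite_eq', mem_univ, if_true]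
  ring

theorem eq_zero_of_cubeFourier_eq_zero {n : ℕ} {F : BinWord n → ℤ}
    (h : ∀ u, cubeFourier F u = 0) (x : BinWord n) : F x = 0 := by
  have h1 := sum_cubeFourier_mul F F
  simp only [h, mul_zero, sum_const_zero] at h1
  have h2 : ∑ x, F x * F x = 0 := by
    rcases mul_eq_zero.mp h1.symm with h3 | h3
    · exact absurd h3 (by positivity)
    · exact h3
  exact mul_self_eq_zero.mp
    ((sum_eq_zero_iff_of_nonneg fun y _ => mul_self_nonneg (F y)).mp h2 x (mem_univ x))

theorem cubeFourier_translate {n : ℕ} (F : BinWord n → ℤ) (z u : BinWord n) :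
    cubeFourier (fun x => F (x + z)) u = cubeChar u z * cubeFourier F u := by
  rw [cubeFourier, cubeFourier, mul_sum, ← Equiv.sum_comp (Equiv.addRight z)]
  refine sum_congr rfl fun x _ => ?_
  simp only [Equiv.coe_addRight, add_cancel_binWord, cubeChar_add]
  ring

theorem cubeFourier_sub {n : ℕ} (F G : BinWord n → ℤ) (u : BinWord n) :
    cubeFourier (fun x => F x - G x) u = cubeFourier F u - cubeFourier G u := by
  simp [cubeFourier, sub_mul]

theorem cubeFourier_add {n : ℕ} (F G : BinWord n → ℤ) (u : BinWord n) :
    cubeFourier (fun x => F x + G x) u = cubeFourier F u + cubeFourier G u := by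
  simp [cubeFourier, add_mul, sum_add_distrib]

theorem cubeFourier_const_mul {n : ℕ} (c : ℤ) (F : BinWord n → ℤ) (u : BinWord n) :
    cubeFourier (fun x => c * F x) u = c * cubeFourier F u := by
  simp [cubeFourier, mul_assoc, mul_sum]

theorem cubeFourier_const {n : ℕ} (c : ℤ) (u : BinWord n) :
    cubeFourier (fun _ => c) u = if u = 0 then c * 2 ^ n else 0 := by
  simp only [cubeFourier, ← mul_sum, cubeChar_comm u, sum_cubeChar, mul_ite, mul_zero]

theorem cubeFourier_zero_right {n : ℕ} (F : BinWord n → ℤ) : cubeFourier F 0 = ∑ x, F x := by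
  simp [cubeFourier, cubeChar_zero_left]

/-- The eigenvalue of `ballSum` at the character `cubeChar u`. -/
def ballEigenvalue {n : ℕ} (u : BinWord n) : ℤ := 1 + ∑ i, cubeChar u (Pi.single i 1)

theorem cubeFourier_ballSum {n : ℕ} (F : BinWord n → ℤ) (u : BinWord n) :
    cubeFourier (ballSum F) u = ballEigenvalue u * cubeFourier F u := by
  have h : cubeFourier (ballSum F) u =
      cubeFourier F u + ∑ i, cubeFourier (fun x => F (x + Pi.single i 1)) u := by
    simp only [cubeFourier, ballSum_eq, add_mul, sum_add_distrib, sum_mul]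
    rw [sum_comm]
  simp only [h, cubeFourier_translate, ballEigenvalue, add_mul, one_mul, sum_mul]

theorem cubeChar_single {n : ℕ} (u : BinWord n) (i : Fin n) :
    cubeChar u (Pi.single i 1) = if u i = 1 then -1 else 1 := by
  rw [cubeChar, prod_eq_single i]
  · simp
  · intro j _ hj
    simp [Pi.single_eq_of_ne hj]
  · simp

theorem ballEigenvalue_eq {n : ℕ} (u : BinWord n) :
    ballEigenvalue u = n + 1 - 2 * ((univ.filter fun i => u i = 1).card : ℤ) := by
  have h : ∀ i, cubeChar u (Pi.single i 1) = 1 - 2 * if u i = 1 then 1 else 0 := by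
    intro i
    rw [cubeChar_single]
    split_ifs <;> norm_num
  simp only [ballEigenvalue, h, sum_sub_distrib, ← mul_sum]
  simp
  ring

theorem ballEigenvalue_zero {n : ℕ} : ballEigenvalue (0 : BinWord n) = n + 1 := by
  simp [ballEigenvalue_eq]

theorem cubeChar_one {n : ℕ} (u : BinWord n) :
    cubeChar u 1 = (-1) ^ (univ.filter fun i => u i = 1).card := by
  simp [cubeChar, prod_ite]

theorem sum_ballSum {n : ℕ} (F : BinWord n → ℤ) : ∑ x, ballSum F x = (n + 1) * ∑ x, F x := by
  rw [← cubeFourier_zero_right, cubeFourier_ballSum, cubeFourier_zero_right, ballEigenvalue_zero]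

/-! ### Spectral argument and the equitable partition -/

/-- When `n ≡ 1 (mod 4)`, characters are either even with `|λ| ≥ 2`, or odd. -/
theorem cubeChar_one_cases {n : ℕ} (hn : n % 4 = 1) (u : BinWord n) :
    (cubeChar u 1 = 1 ∧ 4 ≤ ballEigenvalue u ^ 2) ∨ cubeChar u 1 = -1 := by
  rw [cubeChar_one]
  rcases Nat.even_or_odd (univ.filter fun i => u i = 1).card with he | ho
  · left
    refine ⟨he.neg_one_pow, ?_⟩
    rw [ballEigenvalue_eq]
    obtain ⟨k, hk⟩ := he
    rw [hk]
    obtain ⟨l, rfl⟩ : ∃ l, n = 4 * l + 1 := ⟨n / 4, by omega⟩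
    push_cast
    -- Weight `2k` gives the eigenvalue `4(l - k) + 2`, which is at least 2 or at most -2.
    rcases le_or_gt (k : ℤ) l with h | h <;> nlinarith
  · exact Or.inr ho.neg_one_pow

/-- The codeword indicators of `C₁`, `C₂` and `C₄` have ball sums forced by the quotient matrix of
the equitable partition `(C₁, C₂, C₃, C₄)`. -/
structure IsEquitableTriple {n : ℕ} (f f' h : BinWord n → ℤ) : Prop where
  ball_left : ∀ x, ballSum f x = 1 - h x
  ball_right : ∀ x, ballSum f' x = 1 - h x
  ball_rest : ∀ x, ballSum h x = 2 - 2 * (f x + f' x)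
  nonneg_left : ∀ x, 0 ≤ f x
  nonneg_right : ∀ x, 0 ≤ f' x
  zero_or_one_rest : ∀ x, h x = 0 ∨ h x = 1

theorem codeInd_partTwo {n : ℕ} (C : Finset (BinWord n)) (x : BinWord n) :
    codeInd (partTwo C) x = codeInd C (x + 1) := by
  simp [codeInd, partTwo]

/-- The spectral argument: all terms of the quadratic form `λ² - 2 - 2χ(1)` vanish outside of the
trivial character. -/
theorem cubeFourier_codeInd_vanish {n : ℕ} (hn : n % 4 = 1) {C : Finset (BinWord n)}
    (hC : IsDistThreeCode C) (hcard : ((n : ℤ) + 3) * C.card = 2 ^ n) {u : BinWord n}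
    (hu : u ≠ 0) :
    (ballEigenvalue u ^ 2 - 2 - 2 * cubeChar u 1) * cubeFourier (codeInd C) u ^ 2 = 0 := by
  set F := cubeFourier (codeInd C) with hF
  set p : BinWord n → ℤ := fun u => (ballEigenvalue u ^ 2 - 2 - 2 * cubeChar u 1) * F u ^ 2 with hp
  have hp0 : ∀ u, 0 ≤ p u := by
    intro u
    refine mul_nonneg ?_ (sq_nonneg _)
    rcases cubeChar_one_cases hn u with ⟨h1, h2⟩ | h1
    · linarith
    · nlinarith [sq_nonneg (ballEigenvalue u)]
  have hball : ∀ x, ballSum (codeInd C) x * ballSum (codeInd C) x = ballSum (codeInd C) x := by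
    intro x
    have h1 := (isDistThreeCode_iff C).mp hC x
    have h2 := ballSum_nonneg (codeInd_nonneg C) x
    have : ballSum (codeInd C) x = 0 ∨ ballSum (codeInd C) x = 1 := by omega
    rcases this with h | h <;> rw [h] <;> norm_num
  -- Parseval, with ball sums in {0, 1} and hence equal to their squares.
  have hsum : ∑ u, p u =
      2 ^ n * (((n : ℤ) - 1) * C.card - 2 * ∑ x, codeInd C x * codeInd C (x + 1)) := by
    have h1 := sum_cubeFourier_mul (ballSum (codeInd C)) (ballSum (codeInd C))
    have h2 := sum_cubeFourier_mul (codeInd C) (codeInd C)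
    have h3 := sum_cubeFourier_mul (codeInd C) (fun x => codeInd C (x + 1))
    simp only [hball, sum_ballSum, cubeFourier_ballSum, codeInd_mul_self, sum_codeInd,
      cubeFourier_translate] at h1 h2 h3
    have h4 : ∑ u, p u = ∑ u, (ballEigenvalue u * F u * (ballEigenvalue u * F u))
        - 2 * ∑ u, F u * F u - 2 * ∑ u, F u * (cubeChar u 1 * F u) := by
      rw [mul_sum, mul_sum, ← sum_sub_distrib, ← sum_sub_distrib]
      exact sum_congr rfl fun u _ => by simp only [hp]; ring
    rw [h4, h1, h2, h3]
    ring
  have hzero : p 0 = 2 ^ n * (((n : ℤ) - 1) * C.card) := by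
    simp only [hp, ballEigenvalue_zero, cubeChar_zero_left, hF, cubeFourier_zero_right,
      sum_codeInd]
    -- The cardinality enters through `(n + 1)² - 4 = (n - 1)(n + 3)`.
    rw [← hcard]
    ring
  have hprod : 0 ≤ ∑ x, codeInd C x * codeInd C (x + 1) :=
    sum_nonneg fun x _ => mul_nonneg (codeInd_nonneg C x) (codeInd_nonneg C (x + 1))
  have hrest : ∑ v ∈ univ.erase 0, p v ≤ 0 := by
    have := add_sum_erase univ p (mem_univ 0)
    have h2 : 0 ≤ (2 : ℤ) ^ n * ∑ x, codeInd C x * codeInd C (x + 1) := by positivity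
    rw [hsum, hzero] at this
    linarith
  exact (sum_eq_zero_iff_of_nonneg fun v _ => hp0 v).mp
    (hrest.antisymm (sum_nonneg fun v _ => hp0 v)) u (mem_erase.mpr ⟨hu, mem_univ u⟩)

/-- Only characters with `χ(1) = -1` could distinguish the two sides; for them the vanishing form is
`λ²·|f̂|²`, so `λ·f̂ = 0`. -/
theorem ballSum_codeInd_add_one {n : ℕ} (hn : n % 4 = 1) {C : Finset (BinWord n)}
    (hC : IsDistThreeCode C) (hcard : ((n : ℤ) + 3) * C.card = 2 ^ n) (x : BinWord n) :
    ballSum (codeInd C) (x + 1) = ballSum (codeInd C) x := by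
  refine sub_eq_zero.mp (eq_zero_of_cubeFourier_eq_zero
    (F := fun x => ballSum (codeInd C) (x + 1) - ballSum (codeInd C) x) (fun u => ?_) x)
  rw [cubeFourier_sub, cubeFourier_translate, cubeFourier_ballSum]
  rcases cubeChar_one_cases hn u with ⟨h1, -⟩ | h1
  · rw [h1]; ring
  · have hu : u ≠ 0 := by
      rintro rfl
      rw [cubeChar_zero_left] at h1
      norm_num at h1
    have h2 := cubeFourier_codeInd_vanish hn hC hcard hu
    rw [h1] at h2
    have h3 : (ballEigenvalue u * cubeFourier (codeInd C) u) ^ 2 = 0 := by linear_combination h2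
    rw [pow_eq_zero_iff (by norm_num)] at h3
    rw [h3]; ring

/-- At each nontrivial character either `λ² = 2 + 2χ(1)` or the transform of the indicator is 0; the
constant `n - 1` balances the trivial character. -/
theorem ballSum_ballSum_codeInd {n : ℕ} (hn : n % 4 = 1) {C : Finset (BinWord n)}
    (hC : IsDistThreeCode C) (hcard : ((n : ℤ) + 3) * C.card = 2 ^ n) (x : BinWord n) :
    ballSum (ballSum (codeInd C)) x = 2 * (codeInd C x + codeInd C (x + 1)) + (n - 1) := by
  refine sub_eq_zero.mp (eq_zero_of_cubeFourier_eq_zero (F := fun x => ballSum (ballSum (codeInd C))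
    x - (2 * (codeInd C x + codeInd C (x + 1)) + ((n : ℤ) - 1))) (fun u => ?_) x)
  rw [cubeFourier_sub, cubeFourier_add, cubeFourier_const_mul, cubeFourier_add,
    cubeFourier_translate, cubeFourier_ballSum, cubeFourier_ballSum, cubeFourier_const]
  by_cases hu : u = 0
  · subst hu
    rw [if_pos rfl, ballEigenvalue_zero, cubeChar_zero_left, cubeFourier_zero_right, sum_codeInd]
    linear_combination ((n : ℤ) - 1) * hcard
  · have h2 := cubeFourier_codeInd_vanish hn hC hcard hu
    rw [if_neg hu]
    rcases mul_eq_zero.mp h2 with h3 | h3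
    · linear_combination cubeFourier (codeInd C) u * h3
    · rw [pow_eq_zero_iff (by norm_num)] at h3
      rw [h3]; ring

/-- Antipodal invariance puts a word of `C` in every ball centred in `C₂`, so `C₄` consists exactly
of the words whose balls miss `C`. -/
theorem codeInd_partFour {n : ℕ} {C : Finset (BinWord n)} (hC : IsDistThreeCode C)
    (hanti : ∀ x, ballSum (codeInd C) (x + 1) = ballSum (codeInd C) x) (x : BinWord n) :
    codeInd (partFour C) x = 1 - ballSum (codeInd C) x := by
  have h1 := (isDistThreeCode_iff C).mp hC x
  have h2 := ballSum_nonneg (codeInd_nonneg C) x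
  have h3 : x ∈ partFour C ↔ ballSum (codeInd C) x = 0 := by
    have h4 : x + 1 ∈ C → ballSum (codeInd C) x ≠ 0 := by
      intro hx h0
      have := le_ballSum (codeInd_nonneg C) (x + 1)
      rw [hanti, h0, codeInd, if_pos hx] at this
      norm_num at this
    have h5 : ballSum (codeInd C) x = 0 ↔ ∀ y ∈ C, ¬ hammingDist x y ≤ 1 := by
      rw [ballSum_codeInd]
      norm_cast
      rw [card_eq_zero, filter_eq_empty_iff]
    have h6 : (∀ y ∈ C, ¬ hammingDist x y ≤ 1) ↔ x ∉ C ∧ ∀ y ∈ C, hammingDist x y ≠ 1 := by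
      refine ⟨fun h => ⟨fun hx => h x hx (by simp), fun y hy h' => h y hy h'.le⟩,
        fun h y hy h' => ?_⟩
      rcases Nat.le_one_iff_eq_zero_or_eq_one.mp h' with h0 | h0
      · exact h.1 (hammingDist_eq_zero.mp h0 ▸ hy)
      · exact h.2 y hy h0
    rw [Ne, h5, h6] at h4
    rw [h5, h6]
    simp only [partFour, partThree, partTwo, mem_sdiff, mem_union, mem_filter, mem_univ, true_and]
    constructor
    · intro h
      refine ⟨fun hx => h (Or.inl (Or.inl hx)), fun y hy hd => h ?_⟩
      by_cases hx : x ∈ C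
      · exact Or.inl (Or.inl hx)
      · by_cases hx1 : x + 1 ∈ C
        · exact Or.inl (Or.inr hx1)
        · exact Or.inr ⟨⟨hx, y, hy, hd⟩, hx1⟩
    · rintro h ((hx | hx) | ⟨⟨-, y, hy, hd⟩, -⟩)
      · exact h.1 hx
      · exact h4 hx h
      · exact h.2 y hy hd
  unfold codeInd
  split_ifs with h
  · rw [show ballSum (fun x => if x ∈ C then 1 else 0) x = 0 from h3.mp h]; norm_num
  · have := mt h3.mpr h
    change _ = 1 - ballSum (codeInd C) x
    omega

/-- A distance-3 code with the parameters of a doubly shortened 1-perfect code generates an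
equitable partition. -/
theorem isEquitableTriple_codeInd {n : ℕ} (hn : n % 4 = 1) {C : Finset (BinWord n)}
    (hC : IsDistThreeCode C) (hcard : ((n : ℤ) + 3) * C.card = 2 ^ n) :
    IsEquitableTriple (codeInd C) (codeInd (partTwo C)) (codeInd (partFour C)) := by
  have hanti := ballSum_codeInd_add_one hn hC hcard
  have h4 := codeInd_partFour hC hanti
  have h2 : codeInd (partTwo C) = fun x => codeInd C (x + 1) := funext (codeInd_partTwo C)
  refine ⟨fun x => by rw [h4]; ring, fun x => ?_, fun x => ?_, codeInd_nonneg C,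
    codeInd_nonneg _, codeInd_eq_zero_or_one _⟩
  · rw [h2, ballSum_add_right, hanti, h4]; ring
  · rw [show codeInd (partFour C) = fun x => 1 - ballSum (codeInd C) x from funext h4, ballSum_sub,
      ballSum_one, ballSum_ballSum_codeInd hn hC hcard, h2]
    ring

/-! ### Rigidity of the slices -/

namespace IsEquitableTriple

variable {n : ℕ} {f f' h : BinWord n → ℤ}

/-- The defect `r = h - q` is nonnegative and satisfies `ballSum (ballSum r) = 4r`. Summing over the
cube gives `(n + 1)²·∑ r = 4·∑ r`, so `r = 0` once `n ≥ 2`. -/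
theorem rigidity (T : IsEquitableTriple f f' h) (hn : 2 ≤ n) {p q : BinWord n → ℤ}
    (hq : ∀ x, q x ≤ h x) (hp : ∀ x, ballSum p x + 4 * q x = 4)
    (hpq : ∀ x, ballSum q x + p x = 2) (x : BinWord n) :
    q x = h x ∧ p x = 2 * (f x + f' x) := by
  have hr : ∀ x, p x - 2 * (f x + f' x) = ballSum (fun y => h y - q y) x := by
    intro x
    rw [ballSum_sub]
    linear_combination hpq x - T.ball_rest x
  have hrr : ∀ x, ballSum (ballSum fun y => h y - q y) x = 4 * (h x - q x) := by
    intro x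
    rw [← funext hr, ballSum_sub, ballSum_const_mul, ballSum_add]
    linear_combination hp x - 2 * T.ball_left x - 2 * T.ball_right x
  have hsum : ∑ x, (h x - q x) = 0 := by
    have h1 : ∑ x, ballSum (ballSum fun y => h y - q y) x = ∑ x, 4 * (h x - q x) :=
      sum_congr rfl fun x _ => hrr x
    rw [sum_ballSum, sum_ballSum, ← mul_sum] at h1
    have h2 : (((n : ℤ) + 1) ^ 2 - 4) * ∑ x, (h x - q x) = 0 := by linear_combination h1
    refine (mul_eq_zero.mp h2).resolve_left ?_
    have : (2 : ℤ) ≤ n := by exact_mod_cast hn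
    nlinarith
  have hz : ∀ y, h y - q y = 0 := fun y =>
    (sum_eq_zero_iff_of_nonneg fun y _ => sub_nonneg.mpr (hq y)).mp hsum y (mem_univ y)
  refine ⟨by linarith [hz x], ?_⟩
  have h3 := hr x
  simp only [hz] at h3
  simp only [ballSum, sum_const_zero] at h3
  linarith

theorem eq_of_le_of_ballSum_eq {F G : BinWord n → ℤ} (hle : ∀ x, F x ≤ G x)
    (hball : ∀ x, ballSum G x = ballSum F x) (x : BinWord n) : G x = F x := by
  have h1 := le_ballSum (F := fun y => G y - F y) (fun y => sub_nonneg.mpr (hle y)) x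
  rw [ballSum_sub, hball] at h1
  linarith [hle x]

/-- The lower bound on `b₀₀` leaves `b₁₀ + b₀₁ ≤ 2h ≤ 2`; having the same support, the two middle
slices are equal and at most `h`. Rigidity then applies with `p = b₀₀ + b₁₁`. -/
theorem doubled_unique (T : IsEquitableTriple f f' h) (hn : 2 ≤ n)
    {b₀₀ b₀₁ b₁₀ b₁₁ : BinWord n → ℤ}
    (n₀₁ : ∀ x, 0 ≤ b₀₁ x) (n₁₀ : ∀ x, 0 ≤ b₁₀ x)
    (e₀₀ : ∀ x, ballSum b₀₀ x + b₁₀ x + b₀₁ x = 2) (e₀₁ : ∀ x, ballSum b₀₁ x + b₁₁ x + b₀₀ x = 2)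
    (e₁₁ : ∀ x, ballSum b₁₁ x + b₀₁ x + b₁₀ x = 2)
    (hle : ∀ x, 2 * f x ≤ b₀₀ x) (hs : ∀ x, 0 < b₀₁ x ↔ 0 < b₁₀ x) (x : BinWord n) :
    b₀₀ x = 2 * f x ∧ b₀₁ x = h x ∧ b₁₀ x = h x ∧ b₁₁ x = 2 * f' x := by
  have hq : ∀ x, b₁₀ x = b₀₁ x ∧ b₀₁ x ≤ h x := by
    intro x
    have h1 := ballSum_mono hle x
    rw [ballSum_const_mul, T.ball_left] at h1
    have h2 := e₀₀ x
    have h3 := hs x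
    have h4 := n₀₁ x
    have h5 := n₁₀ x
    rcases T.zero_or_one_rest x with h6 | h6 <;> omega
  have hrig := T.rigidity hn (p := fun x => b₀₀ x + b₁₁ x) (fun x => (hq x).2)
    (fun x => by rw [ballSum_add]; linarith [e₀₀ x, e₁₁ x, (hq x).1])
    (fun x => by linarith [e₀₁ x])
  have hf : ∀ x, b₀₀ x = 2 * f x := eq_of_le_of_ballSum_eq hle fun x => by
    rw [ballSum_const_mul, T.ball_left]
    linarith [e₀₀ x, (hq x).1, (hrig x).1]
  refine ⟨hf x, (hrig x).1, (hq x).1.trans (hrig x).1, ?_⟩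
  linarith [hf x, (hrig x).2]

/-- Two nonnegative integers that are both zero or both positive, with sum at most 2, are equal:
this gives `b₁₁ = b₀₀` and `b₁₀ = b₀₁`. Where `h = 0` the sum `b₁₀ + b₀₁` is at most 1, so both
vanish. Rigidity applies with `p = 2b₀₀`. -/
theorem invariant_unique (T : IsEquitableTriple f f' h) (hn : 2 ≤ n)
    {b₀₀ b₀₁ b₁₀ b₁₁ : BinWord n → ℤ} (n₀₀ : ∀ x, 0 ≤ b₀₀ x)
    (n₀₁ : ∀ x, 0 ≤ b₀₁ x) (n₁₀ : ∀ x, 0 ≤ b₁₀ x) (n₁₁ : ∀ x, 0 ≤ b₁₁ x)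
    (e₀₀ : ∀ x, ballSum b₀₀ x + b₁₀ x + b₀₁ x = 2) (e₀₁ : ∀ x, ballSum b₀₁ x + b₁₁ x + b₀₀ x = 2)
    (hle : ∀ x, f x ≤ b₀₀ x) (hs : ∀ x, 0 < b₀₁ x ↔ 0 < b₁₀ x)
    (hs' : ∀ x, 0 < b₀₀ x ↔ 0 < b₁₁ x) (x : BinWord n) :
    b₀₀ x = f x + f' x ∧ b₀₁ x = h x ∧ b₁₀ x = h x ∧ b₁₁ x = f x + f' x := by
  have hp : ∀ x, b₁₁ x = b₀₀ x := by
    intro x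
    have h1 := ballSum_nonneg n₀₁ x
    have h2 := e₀₁ x
    have h3 := hs' x
    have h4 := n₀₀ x
    have h5 := n₁₁ x
    omega
  have hq : ∀ x, b₁₀ x = b₀₁ x ∧ b₀₁ x ≤ h x := by
    intro x
    have h1 := ballSum_mono hle x
    rw [T.ball_left] at h1
    have h2 := e₀₀ x
    have h3 := hs x
    have h4 := n₀₁ x
    have h5 := n₁₀ x
    rcases T.zero_or_one_rest x with h6 | h6
    · omega
    · have := ballSum_nonneg n₀₀ x
      omega
  have hrig := T.rigidity hn (p := fun x => 2 * b₀₀ x) (fun x => (hq x).2)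
    (fun x => by rw [ballSum_const_mul]; linarith [e₀₀ x, (hq x).1])
    (fun x => by linarith [e₀₁ x, hp x])
  have h1 := (hrig x).2
  have h2 := hp x
  refine ⟨by linarith, (hrig x).1, (hq x).1.trans (hrig x).1, by linarith⟩

end IsEquitableTriple

/-! ### Slices by the last two symbols -/

/-- The word `x` obtained from `x a b` by removing the last two symbols. -/
def dropTwo {n : ℕ} (w : BinWord (n + 2)) : BinWord n := fun i => w (Fin.castAdd 2 i)

theorem appendTwo_dropTwo {n : ℕ} (w : BinWord (n + 2)) :
    appendTwo (dropTwo w) (w (Fin.natAdd n 0)) (w (Fin.natAdd n 1)) = w := by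
  refine funext fun i => ?_
  refine Fin.addCases (fun i => ?_) (fun j => ?_) i
  · simp [appendTwo, dropTwo]
  · fin_cases j <;> simp [appendTwo]

theorem dropTwo_appendTwo {n : ℕ} (x : BinWord n) (a b : ZMod 2) :
    dropTwo (appendTwo x a b) = x := by
  funext i; simp [dropTwo, appendTwo]

theorem appendTwo_apply_zero {n : ℕ} (x : BinWord n) (a b : ZMod 2) :
    appendTwo x a b (Fin.natAdd n 0) = a := by
  rw [appendTwo, Fin.append_right]; rfl

theorem appendTwo_apply_one {n : ℕ} (x : BinWord n) (a b : ZMod 2) :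
    appendTwo x a b (Fin.natAdd n 1) = b := by
  rw [appendTwo, Fin.append_right]; rfl

theorem appendTwo_add {n : ℕ} (x y : BinWord n) (a b c d : ZMod 2) :
    appendTwo x a b + appendTwo y c d = appendTwo (x + y) (a + c) (b + d) := by
  refine funext fun i => ?_
  refine Fin.addCases (fun i => ?_) (fun j => ?_) i
  · simp [appendTwo]
  · fin_cases j <;> simp [appendTwo]

theorem single_castAdd_eq {n : ℕ} (i : Fin n) :
    (Pi.single (Fin.castAdd 2 i) 1 : BinWord (n + 2)) = appendTwo (Pi.single i 1) 0 0 := by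
  refine funext fun k => ?_
  refine Fin.addCases (fun k => ?_) (fun j => ?_) k
  · simp [appendTwo, Pi.single_apply]
  · have : (Fin.natAdd n j) ≠ Fin.castAdd 2 i := by
      rw [Ne, Fin.ext_iff]; simp; omega
    rw [Pi.single_eq_of_ne this]
    fin_cases j <;> simp [appendTwo]

theorem single_natAdd_eq {n : ℕ} (j : Fin 2) :
    (Pi.single (Fin.natAdd n j) 1 : BinWord (n + 2)) =
      appendTwo 0 (if j = 0 then 1 else 0) (if j = 1 then 1 else 0) := by
  refine funext fun k => ?_
  refine Fin.addCases (fun k => ?_) (fun l => ?_) k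
  · have : Fin.castAdd 2 k ≠ Fin.natAdd n j := by
      rw [Ne, Fin.ext_iff]; simp; omega
    rw [Pi.single_eq_of_ne this]
    simp [appendTwo]
  · fin_cases j <;> fin_cases l <;> simp [appendTwo]

theorem forall_appendTwo {n : ℕ} {P : BinWord (n + 2) → Prop} :
    (∀ w, P w) ↔ ∀ x, P (appendTwo x 0 0) ∧ P (appendTwo x 0 1) ∧ P (appendTwo x 1 0) ∧
      P (appendTwo x 1 1) := by
  refine ⟨fun h x => ⟨h _, h _, h _, h _⟩, fun h w => ?_⟩
  rw [← appendTwo_dropTwo w]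
  obtain ⟨h1, h2, h3, h4⟩ := h (dropTwo w)
  rcases ZMod.eq_zero_or_eq_one_of_two (w (Fin.natAdd n 0)) with ha | ha <;>
  rcases ZMod.eq_zero_or_eq_one_of_two (w (Fin.natAdd n 1)) with hb | hb <;>
  rw [ha, hb] <;> assumption

theorem ballSum_appendTwo {n : ℕ} (G : BinWord (n + 2) → ℤ) (x : BinWord n) (a b : ZMod 2) :
    ballSum G (appendTwo x a b) = ballSum (fun y => G (appendTwo y a b)) x +
      G (appendTwo x (a + 1) b) + G (appendTwo x a (b + 1)) := by
  rw [ballSum_eq, ballSum_eq, Fin.sum_univ_add, Fin.sum_univ_two]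
  simp only [single_castAdd_eq, single_natAdd_eq, appendTwo_add, add_zero, if_true, zero_ne_one,
    one_ne_zero, if_false]
  ring

theorem forall_ballSum_appendTwo {n : ℕ} {G : BinWord (n + 2) → ℤ} {c : ℤ} :
    (∀ w, ballSum G w = c) ↔ ∀ x : BinWord n,
      ballSum (fun y => G (appendTwo y 0 0)) x + G (appendTwo x 1 0) + G (appendTwo x 0 1) = c ∧
      ballSum (fun y => G (appendTwo y 0 1)) x + G (appendTwo x 1 1) + G (appendTwo x 0 0) = c ∧
      ballSum (fun y => G (appendTwo y 1 0)) x + G (appendTwo x 0 0) + G (appendTwo x 1 1) = c ∧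
      ballSum (fun y => G (appendTwo y 1 1)) x + G (appendTwo x 0 1) + G (appendTwo x 1 0) = c := by
  rw [forall_appendTwo]
  simp only [ballSum_appendTwo, CharTwo.add_self_eq_zero, zero_add]

/-- The function on words whose restrictions to words with fixed last two symbols are the
given functions. -/
def tailCases {n : ℕ} {β : Type*} (b₀₀ b₀₁ b₁₀ b₁₁ : BinWord n → β) (w : BinWord (n + 2)) : β :=
  if w (Fin.natAdd n 0) = 0 then
    if w (Fin.natAdd n 1) = 0 then b₀₀ (dropTwo w) else b₀₁ (dropTwo w)
  else if w (Fin.natAdd n 1) = 0 then b₁₀ (dropTwo w) else b₁₁ (dropTwo w)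

section tailCases

variable {n : ℕ} {β : Type*} (b₀₀ b₀₁ b₁₀ b₁₁ : BinWord n → β) (x : BinWord n)

theorem tailCases_zero_zero : tailCases b₀₀ b₀₁ b₁₀ b₁₁ (appendTwo x 0 0) = b₀₀ x := by
  simp only [tailCases, appendTwo_apply_zero, appendTwo_apply_one, dropTwo_appendTwo, if_true]

theorem tailCases_zero_one : tailCases b₀₀ b₀₁ b₁₀ b₁₁ (appendTwo x 0 1) = b₀₁ x := by
  simp only [tailCases, appendTwo_apply_zero, appendTwo_apply_one, dropTwo_appendTwo, if_true,
    one_ne_zero, if_false]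

theorem tailCases_one_zero : tailCases b₀₀ b₀₁ b₁₀ b₁₁ (appendTwo x 1 0) = b₁₀ x := by
  simp only [tailCases, appendTwo_apply_zero, appendTwo_apply_one, dropTwo_appendTwo, if_true,
    one_ne_zero, if_false]

theorem tailCases_one_one : tailCases b₀₀ b₀₁ b₁₀ b₁₁ (appendTwo x 1 1) = b₁₁ x := by
  simp only [tailCases, appendTwo_apply_zero, appendTwo_apply_one, dropTwo_appendTwo,
    one_ne_zero, if_false]

end tailCases

theorem exists_multiset_count_eq {α : Type*} [Fintype α] [DecidableEq α] (g : α → ℕ) :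
    ∃ B : Multiset α, ∀ a, B.count a = g a := by
  refine ⟨∑ a, Multiset.replicate (g a) a, fun a => ?_⟩
  simp [Multiset.count_sum', Multiset.count_replicate]

theorem exists_multiset_slices {n : ℕ} {b₀₀ b₀₁ b₁₀ b₁₁ : BinWord n → ℤ} (n₀₀ : ∀ x, 0 ≤ b₀₀ x)
    (n₀₁ : ∀ x, 0 ≤ b₀₁ x) (n₁₀ : ∀ x, 0 ≤ b₁₀ x) (n₁₁ : ∀ x, 0 ≤ b₁₁ x) :
    ∃ B : Multiset (BinWord (n + 2)), ∀ x, (B.count (appendTwo x 0 0) : ℤ) = b₀₀ x ∧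
      (B.count (appendTwo x 0 1) : ℤ) = b₀₁ x ∧ (B.count (appendTwo x 1 0) : ℤ) = b₁₀ x ∧
      (B.count (appendTwo x 1 1) : ℤ) = b₁₁ x := by
  obtain ⟨B, hB⟩ := exists_multiset_count_eq fun w => (tailCases b₀₀ b₀₁ b₁₀ b₁₁ w).toNat
  refine ⟨B, fun x => ?_⟩
  rw [hB, hB, hB, hB, tailCases_zero_zero, tailCases_zero_one, tailCases_one_zero,
    tailCases_one_one]
  exact ⟨Int.toNat_of_nonneg (n₀₀ x), Int.toNat_of_nonneg (n₀₁ x), Int.toNat_of_nonneg (n₁₀ x),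
    Int.toNat_of_nonneg (n₁₁ x)⟩

theorem multiset_eq_of_slices {n : ℕ} {B B' : Multiset (BinWord (n + 2))}
    {b₀₀ b₀₁ b₁₀ b₁₁ : BinWord n → ℤ}
    (h : ∀ x, (B.count (appendTwo x 0 0) : ℤ) = b₀₀ x ∧
      (B.count (appendTwo x 0 1) : ℤ) = b₀₁ x ∧ (B.count (appendTwo x 1 0) : ℤ) = b₁₀ x ∧
      (B.count (appendTwo x 1 1) : ℤ) = b₁₁ x)
    (h' : ∀ x, (B'.count (appendTwo x 0 0) : ℤ) = b₀₀ x ∧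
      (B'.count (appendTwo x 0 1) : ℤ) = b₀₁ x ∧ (B'.count (appendTwo x 1 0) : ℤ) = b₁₀ x ∧
      (B'.count (appendTwo x 1 1) : ℤ) = b₁₁ x) : B = B' := by
  refine Multiset.ext.mpr (forall_appendTwo.mpr fun x => ?_)
  obtain ⟨h1, h2, h3, h4⟩ := h x
  obtain ⟨h1', h2', h3', h4'⟩ := h' x
  refine ⟨?_, ?_, ?_, ?_⟩ <;> omega

/-! ### Explicit slices of the two twofold codes -/

theorem zero_lt_count_iff {α : Type*} [DecidableEq α] {B : Multiset α} {w : α} :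
    0 < (B.count w : ℤ) ↔ w ∈ B := by
  rw [Nat.cast_pos, Multiset.count_pos]

theorem isDoubledTwofoldExtension_iff {n : ℕ} (hn : 2 ≤ n) {C₁ : Finset (BinWord n)}
    {f' h : BinWord n → ℤ} (T : IsEquitableTriple (codeInd C₁) f' h)
    (B : Multiset (BinWord (n + 2))) :
    IsDoubledTwofoldExtension C₁ B ↔ ∀ x, (B.count (appendTwo x 0 0) : ℤ) = 2 * codeInd C₁ x ∧
      (B.count (appendTwo x 0 1) : ℤ) = h x ∧ (B.count (appendTwo x 1 0) : ℤ) = h x ∧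
      (B.count (appendTwo x 1 1) : ℤ) = 2 * f' x := by
  rw [IsDoubledTwofoldExtension, isTwofoldOnePerfect_iff, forall_ballSum_appendTwo]
  simp only [appendTwo_add, add_zero, zero_add, CharTwo.add_self_eq_zero]
  constructor
  · rintro ⟨hE, -, h2, h01, h10⟩
    refine T.doubled_unique hn (fun x => Nat.cast_nonneg _) (fun x => Nat.cast_nonneg _)
      (fun x => (hE x).1) (fun x => (hE x).2.1) (fun x => (hE x).2.2.2) (fun x => ?_) fun x => ?_
    · unfold codeInd
      split_ifs with hx
      · rw [h2 x hx]; norm_num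
      · simp
    · rw [zero_lt_count_iff, zero_lt_count_iff]
      exact ⟨h01 x, h10 x⟩
  · intro hB
    have hC : ∀ x ∈ C₁, B.count (appendTwo x 0 0) = 2 := by
      intro x hx
      have := (hB x).1
      rw [codeInd, if_pos hx] at this
      omega
    refine ⟨fun x => ?_, fun x hx => ?_, hC, fun x hx => ?_, fun x hx => ?_⟩
    · obtain ⟨h1, h2, h3, h4⟩ := hB x
      simp only [fun y => (hB y).1, fun y => (hB y).2.1, fun y => (hB y).2.2.1,
        fun y => (hB y).2.2.2, ballSum_const_mul]
      have := T.ball_left x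
      have := T.ball_right x
      have := T.ball_rest x
      refine ⟨?_, ?_, ?_, ?_⟩ <;> linarith
    · rw [← Multiset.count_pos, hC x hx]; norm_num
    · rw [← zero_lt_count_iff] at hx ⊢
      rwa [(hB x).2.2.1, ← (hB x).2.1]
    · rw [← zero_lt_count_iff] at hx ⊢
      rwa [(hB x).2.1, ← (hB x).2.2.1]

theorem isInvariantTwofoldExtension_iff {n : ℕ} (hn : 2 ≤ n) {C₁ : Finset (BinWord n)}
    {f' h : BinWord n → ℤ} (T : IsEquitableTriple (codeInd C₁) f' h)
    (D : Multiset (BinWord (n + 2))) :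
    IsInvariantTwofoldExtension C₁ D ↔ ∀ x,
      (D.count (appendTwo x 0 0) : ℤ) = codeInd C₁ x + f' x ∧
      (D.count (appendTwo x 0 1) : ℤ) = h x ∧ (D.count (appendTwo x 1 0) : ℤ) = h x ∧
      (D.count (appendTwo x 1 1) : ℤ) = codeInd C₁ x + f' x := by
  rw [IsInvariantTwofoldExtension, isTwofoldOnePerfect_iff, forall_ballSum_appendTwo,
    forall_appendTwo (P := fun w => w ∈ D → w + appendTwo 0 1 1 ∈ D)]
  simp only [appendTwo_add, add_zero, zero_add, CharTwo.add_self_eq_zero, ← zero_lt_count_iff]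
  constructor
  · rintro ⟨hE, hC, hs⟩
    refine T.invariant_unique hn (fun x => Nat.cast_nonneg _) (fun x => Nat.cast_nonneg _)
      (fun x => Nat.cast_nonneg _) (fun x => Nat.cast_nonneg _)
      (fun x => (hE x).1) (fun x => (hE x).2.1) (fun x => ?_)
      (fun x => ⟨(hs x).2.1, (hs x).2.2.1⟩) fun x => ⟨(hs x).1, (hs x).2.2.2⟩
    unfold codeInd
    split_ifs with hx
    · exact hC x hx
    · simp
  · intro hD
    simp only [fun y => (hD y).1, fun y => (hD y).2.1, fun y => (hD y).2.2.1,
        fun y => (hD y).2.2.2, ballSum_add]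
    refine ⟨fun x => ?_, fun x hx => ?_, fun x => ⟨id, id, id, id⟩⟩
    · have := T.ball_left x
      have := T.ball_right x
      have := T.ball_rest x
      refine ⟨?_, ?_, ?_, ?_⟩ <;> linarith
    · rw [codeInd, if_pos hx]
      linarith [T.nonneg_right x]

/-! ### Perfect codes and splittings -/

/-- The code obtained by interchanging the last two symbols. -/
def swapLastTwo {n : ℕ} (C : Finset (BinWord (n + 2))) : Finset (BinWord (n + 2)) :=
  univ.filter fun w => appendTwo (dropTwo w) (w (Fin.natAdd n 1)) (w (Fin.natAdd n 0)) ∈ C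

theorem codeInd_swapLastTwo {n : ℕ} (C : Finset (BinWord (n + 2))) (x : BinWord n)
    (a b : ZMod 2) : codeInd (swapLastTwo C) (appendTwo x a b) = codeInd C (appendTwo x b a) := by
  simp only [codeInd, swapLastTwo, mem_filter, mem_univ, true_and, dropTwo_appendTwo,
    appendTwo_apply_zero, appendTwo_apply_one]

theorem IsOnePerfect.swapLastTwo {n : ℕ} {C : Finset (BinWord (n + 2))} (hC : IsOnePerfect C) :
    IsOnePerfect (swapLastTwo C) := by
  rw [isOnePerfect_iff, forall_ballSum_appendTwo] at hC ⊢
  intro x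
  obtain ⟨h1, h2, h3, h4⟩ := hC x
  simp only [codeInd_swapLastTwo]
  refine ⟨?_, ?_, ?_, ?_⟩ <;> linarith

/-- The translation of a code by a word. -/
def translateCode {n : ℕ} (C : Finset (BinWord n)) (z : BinWord n) : Finset (BinWord n) :=
  univ.filter fun w => w + z ∈ C

theorem codeInd_translateCode {n : ℕ} (C : Finset (BinWord n)) (z w : BinWord n) :
    codeInd (translateCode C z) w = codeInd C (w + z) := by
  simp [codeInd, translateCode]

theorem IsOnePerfect.translateCode {n : ℕ} {C : Finset (BinWord n)} (hC : IsOnePerfect C)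
    (z : BinWord n) : IsOnePerfect (translateCode C z) := by
  rw [isOnePerfect_iff] at hC ⊢
  intro w
  rw [show codeInd (_root_.translateCode C z) = fun w => codeInd C (w + z) from
    funext (codeInd_translateCode C z), ballSum_add_right, hC]

theorem IsOnePerfect.isTwofoldOnePerfect_add {n : ℕ} {C C' : Finset (BinWord n)}
    (hC : IsOnePerfect C) (hC' : IsOnePerfect C') : IsTwofoldOnePerfect (C.val + C'.val) := by
  rw [isOnePerfect_iff] at hC hC'
  rw [isTwofoldOnePerfect_iff]
  intro x
  simp only [Multiset.count_add, Nat.cast_add, count_val_eq_codeInd, ballSum_add, hC, hC']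
  norm_num

/-- The swap fixes words ending in 00, which doubles `C₁00`, and acts on words ending in 01 or 10 as
addition of 0…011. -/
theorem IsOnePerfect.isDoubledTwofoldExtension {n : ℕ} {C₁ : Finset (BinWord n)}
    {C : Finset (BinWord (n + 2))} (hC : IsOnePerfect C) (hsub : ∀ x ∈ C₁, appendTwo x 0 0 ∈ C) :
    IsDoubledTwofoldExtension C₁ (C.val + (_root_.swapLastTwo C).val) := by
  have hmem : ∀ x a b, appendTwo x a b ∈ _root_.swapLastTwo C ↔ appendTwo x b a ∈ C := by
    intro x a b
    simp only [_root_.swapLastTwo, mem_filter, mem_univ, true_and, dropTwo_appendTwo,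
      appendTwo_apply_zero, appendTwo_apply_one]
  refine ⟨hC.isTwofoldOnePerfect_add hC.swapLastTwo, fun x hx => ?_, fun x hx => ?_,
    fun x hx => ?_, fun x hx => ?_⟩
  · exact Multiset.mem_add.mpr (Or.inl (hsub x hx))
  · rw [Multiset.count_add, Multiset.count_eq_one_of_mem C.nodup (hsub x hx),
      Multiset.count_eq_one_of_mem (Finset.nodup _) ((hmem x 0 0).mpr (hsub x hx))]
  · simp only [appendTwo_add, add_zero, zero_add, CharTwo.add_self_eq_zero, Multiset.mem_add,
      mem_val, hmem] at hx ⊢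
    exact hx.symm
  · simp only [appendTwo_add, add_zero, zero_add, CharTwo.add_self_eq_zero, Multiset.mem_add,
      mem_val, hmem] at hx ⊢
    exact hx.symm

theorem IsOnePerfect.isInvariantTwofoldExtension {n : ℕ} {C₁ : Finset (BinWord n)}
    {C : Finset (BinWord (n + 2))} (hC : IsOnePerfect C) (hsub : ∀ x ∈ C₁, appendTwo x 0 0 ∈ C) :
    IsInvariantTwofoldExtension C₁
      (C.val + (_root_.translateCode C (appendTwo 0 1 1)).val) := by
  refine ⟨hC.isTwofoldOnePerfect_add (hC.translateCode _), fun x hx => ?_, fun w hw => ?_⟩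
  · exact Multiset.mem_add.mpr (Or.inl (hsub x hx))
  · simp only [Multiset.mem_add, mem_val, _root_.translateCode, mem_filter, mem_univ, true_and,
      add_cancel_binWord] at hw ⊢
    exact hw.symm

/-- A slice of a distance-3 code is a distance-3 code, so a splitting can be cut slice by slice. -/
theorem IsSplittable.slice {n : ℕ} {B : Multiset (BinWord (n + 2))} (hB : IsSplittable B)
    {a b : ZMod 2} {K : Finset (BinWord n)}
    (hK : ∀ x, (B.count (appendTwo x a b) : ℤ) = codeInd K x) : IsSplittable K.val := by
  obtain ⟨C', C'', h', h'', rfl⟩ := hB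
  have hslice : ∀ C : Finset (BinWord (n + 2)), ∀ x,
      codeInd (univ.filter fun x => appendTwo x a b ∈ C) x = codeInd C (appendTwo x a b) := by
    intro C x
    simp [codeInd]
  have hdist : ∀ C : Finset (BinWord (n + 2)), IsDistThreeCode C →
      IsDistThreeCode (univ.filter fun x => appendTwo x a b ∈ C) := by
    intro C hC
    rw [isDistThreeCode_iff] at hC ⊢
    intro x
    have h1 := hC (appendTwo x a b)
    rw [ballSum_appendTwo] at h1
    rw [funext (hslice C)]
    linarith [codeInd_nonneg C (appendTwo x (a + 1) b), codeInd_nonneg C (appendTwo x a (b + 1))]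
  refine ⟨_, _, hdist C' h', hdist C'' h'', Multiset.ext.mpr fun x => ?_⟩
  have h1 := hK x
  rw [Multiset.count_add] at h1 ⊢
  push_cast at h1
  zify
  rw [count_val_eq_codeInd, count_val_eq_codeInd, count_val_eq_codeInd, hslice, hslice, ← h1,
    count_val_eq_codeInd, count_val_eq_codeInd]

theorem exists_isOnePerfect_of_isSplittable {n : ℕ} {C₁ C₂ C₄ : Finset (BinWord n)}
    (T : IsEquitableTriple (codeInd C₁) (codeInd C₂) (codeInd C₄)) (hs : IsSplittable C₄.val) :
    ∃ C : Finset (BinWord (n + 2)), IsOnePerfect C ∧ ∀ x ∈ C₁, appendTwo x 0 0 ∈ C := by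
  obtain ⟨K', K'', h', h'', hK⟩ := hs
  rw [isDistThreeCode_iff] at h' h''
  have hsum : ∀ x, codeInd C₄ x = codeInd K' x + codeInd K'' x := by
    intro x
    rw [← count_val_eq_codeInd, hK, Multiset.count_add, Nat.cast_add, count_val_eq_codeInd,
      count_val_eq_codeInd]
  have hball : ∀ x, ballSum (codeInd K') x + ballSum (codeInd K'') x =
      2 - 2 * (codeInd C₁ x + codeInd C₂ x) := by
    intro x
    rw [← T.ball_rest, ← ballSum_add, funext hsum]
  classical
  refine ⟨univ.filter fun w => tailCases (· ∈ C₁) (· ∈ K') (· ∈ K'') (· ∈ C₂) w, ?_,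
    fun x hx => by simpa [tailCases_zero_zero] using hx⟩
  rw [isOnePerfect_iff, forall_ballSum_appendTwo]
  intro x
  have h1 := T.ball_left x
  have h2 := T.ball_right x
  have h3 := hsum x
  have h4 := hball x
  have h5 := h' x
  have h6 := h'' x
  have h7 := ballSum_nonneg (codeInd_nonneg K') x
  have h8 := ballSum_nonneg (codeInd_nonneg K'') x
  have h9 := codeInd_nonneg C₁ x
  have h10 := codeInd_nonneg C₂ x
  unfold codeInd at *
  simp only [mem_filter, mem_univ, true_and, tailCases_zero_zero, tailCases_zero_one,
    tailCases_one_zero, tailCases_one_one]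
  -- The ball sums of `K'` and `K''` are at most 1 and add up to 0 or 2, so each equals `1 - f -
  -- f'`, with `f, f'` the indicators of `C₁, C₂`.
  refine ⟨?_, ?_, ?_, ?_⟩ <;> omega

/-! ### The main theorem -/

theorem mainTheorem2 (m n : ℕ) (hm : 3 ≤ m) (hn : n = 2 ^ m - 3)
    (C₁ : Finset (BinWord n)) (hcard : C₁.card = 2 ^ (2 ^ m - m - 3))
    (hdist : IsDistThreeCode C₁) :
    (∃! B : Multiset (BinWord (n + 2)), IsDoubledTwofoldExtension C₁ B) ∧
    (∃! D : Multiset (BinWord (n + 2)), IsInvariantTwofoldExtension C₁ D) ∧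
    ∀ B D : Multiset (BinWord (n + 2)),
      IsDoubledTwofoldExtension C₁ B → IsInvariantTwofoldExtension C₁ D →
      List.TFAE
        [(∃ C : Finset (BinWord (n + 2)), IsOnePerfect C ∧ ∀ x ∈ C₁, appendTwo x 0 0 ∈ C),
          IsSplittable (partFour C₁).val,
          IsSplittable B,
          IsSplittable D] := by
  obtain ⟨k, rfl⟩ : ∃ k, m = k + 3 := ⟨m - 3, by omega⟩
  have hpow : 2 ^ (k + 3) = 8 * 2 ^ k := by ring
  -- This bound keeps the natural subtraction in the exponent `2 ^ m - m - 3` from truncating.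
  have hk : k < 2 ^ k := Nat.lt_two_pow_self
  have hn2 : 2 ≤ n := by omega
  have hn4 : n % 4 = 1 := by omega
  have hcard' : ((n : ℤ) + 3) * C₁.card = 2 ^ n := by
    have h1 : (n + 3) * C₁.card = 2 ^ n := by
      rw [hcard, show n + 3 = 2 ^ (k + 3) by omega, ← pow_add]
      congr 1
      omega
    exact_mod_cast h1
  have T := isEquitableTriple_codeInd hn4 hdist hcard'
  have hB := isDoubledTwofoldExtension_iff hn2 T
  have hD := isInvariantTwofoldExtension_iff hn2 T
  have n₁ := codeInd_nonneg C₁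
  have n₂ := codeInd_nonneg (partTwo C₁)
  have n₄ := codeInd_nonneg (partFour C₁)
  refine ⟨?_, ?_, fun B D hB₁ hD₁ => ?_⟩
  · obtain ⟨B, h⟩ := exists_multiset_slices (fun x => mul_nonneg zero_le_two (n₁ x)) n₄ n₄
      (fun x => mul_nonneg zero_le_two (n₂ x))
    exact ⟨B, (hB B).mpr h, fun B' h' => multiset_eq_of_slices ((hB B').mp h') h⟩
  · obtain ⟨D, h⟩ := exists_multiset_slices (fun x => add_nonneg (n₁ x) (n₂ x)) n₄ n₄
      (fun x => add_nonneg (n₁ x) (n₂ x))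
    exact ⟨D, (hD D).mpr h, fun D' h' => multiset_eq_of_slices ((hD D').mp h') h⟩
  · have hB₂ := (hB B).mp hB₁
    have hD₂ := (hD D).mp hD₁
    tfae_have 1 → 3 := by
      rintro ⟨C, hC, hsub⟩
      exact ⟨C, _, hC.isDistThreeCode, hC.swapLastTwo.isDistThreeCode,
        multiset_eq_of_slices hB₂ ((hB _).mp (hC.isDoubledTwofoldExtension hsub))⟩
    tfae_have 1 → 4 := by
      rintro ⟨C, hC, hsub⟩
      exact ⟨C, _, hC.isDistThreeCode, (hC.translateCode _).isDistThreeCode,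
        multiset_eq_of_slices hD₂ ((hD _).mp (hC.isInvariantTwofoldExtension hsub))⟩
    tfae_have 3 → 2 := fun h => h.slice fun x => (hB₂ x).2.1
    tfae_have 4 → 2 := fun h => h.slice fun x => (hD₂ x).2.1
    tfae_have 2 → 1 := exists_isOnePerfect_of_isSplittable T
    tfae_finish
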